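/- Rings are associative and not necessarily unital. A nonzero ring $R$ is prime if $aRb=0$ with $a,b\in R$ implies $a=0$ or $b=0$. For a prime ring $R$, let $Q_s(R)\supseteq R$ be its Martindale symmetric ring of quotients and let $C$, the center of $Q_s(R)$, be its extended centroid (a field). For a subset $A\subseteq R$ let $AC$ be the additive subgroup of $Q_s(R)$ generated by all $ac$ with $a\in A$, $c\in C$. A Lie ideal of $R$ is an additive subgroup $K$ with $ar-ra\in K$ for all $a\in K$, $r\in R$; it is noncentral if it is not contained in the center $Z(R)$. The product $K_1\cdots K_m$ is the additive subgroup of $R$ generated by all products $a_1\cdots a_m$ with $a_i\in K_i$. **Theorem.** Let $R$ be a prime ring with noncentral Lie ideals $K_1,\ldots,K_m$, where $m\ge 1$. Then one of the following two cases holds: - the centralizer of $K_1\cdots K_m$ in $R$ is $Z(R)$, that is, $\{x\in R: ax=xa\ \text{for all}\ a\in K_1\cdots K_m\}=Z(R)$; or - $K_jC=K_1C$ for $j=1,\ldots,m$, $\dim_C K_1C=2$, and the centralizer of $K_1\cdots K_m$ in $RC$ is $K_1C$, that is, $\{x\in RC: ax=xa\ \text{for all}\ a\in K_1\cdots K_m\}=K_1C$.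 -/

import Mathlib

/-! ### Prime rings -/

/-- A (not necessarily unital) associative ring `R` is prime if it is nonzero and
`a R b = 0` implies `a = 0` or `b = 0`. -/
class IsPrimeRing (R : Type*) [NonUnitalRing R] : Prop extends Nontrivial R where
  eq_zero_or_eq_zero : ∀ a b : R, (∀ r : R, a * r * b = 0) → a = 0 ∨ b = 0

namespace Martindale

variable {R : Type*} [NonUnitalRing R]

/-- The product `J I` of two ideals: the additive subgroup generated by all products. -/
def mulIdeal (J I : TwoSidedIdeal R) : TwoSidedIdeal R :=
  TwoSidedIdeal.mk' (AddSubgroup.closure {z : R | ∃ x ∈ J, ∃ y ∈ I, z = x * y} : AddSubgroup R)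
    (zero_mem _) (fun hx hy => add_mem hx hy) (fun hx => neg_mem hx)
    (by
      intro r z hz
      simp only [SetLike.mem_coe] at hz ⊢
      induction hz using AddSubgroup.closure_induction with
      | mem z hz =>
        obtain ⟨x, hx, y, hy, rfl⟩ := hz
        exact AddSubgroup.subset_closure
          ⟨r * x, J.mul_mem_left _ _ hx, y, hy, (mul_assoc _ _ _).symm⟩
      | zero => simp
      | add a b _ _ ha hb => rw [mul_add]; exact add_mem ha hb
      | neg a _ ha => rw [mul_neg]; exact neg_mem ha)
    (by
      intro z r hz
      simp only [SetLike.mem_coe] at hz ⊢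
      induction hz using AddSubgroup.closure_induction with
      | mem z hz =>
        obtain ⟨x, hx, y, hy, rfl⟩ := hz
        exact AddSubgroup.subset_closure
          ⟨x, hx, y * r, I.mul_mem_right _ _ hy, mul_assoc _ _ _⟩
      | zero => simp
      | add a b _ _ ha hb => rw [add_mul]; exact add_mem ha hb
      | neg a _ ha => rw [neg_mul]; exact neg_mem ha)

theorem mul_mem_mulIdeal {J I : TwoSidedIdeal R} {x y : R} (hx : x ∈ J) (hy : y ∈ I) :
    x * y ∈ mulIdeal J I :=
  (TwoSidedIdeal.mem_mk' _ _ _ _ _ _ _).2 (AddSubgroup.subset_closure ⟨x, hx, y, hy, rfl⟩)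

theorem mulIdeal_induction {J I : TwoSidedIdeal R} {p : R → Prop}
    (mul : ∀ x ∈ J, ∀ y ∈ I, p (x * y)) (zero : p 0)
    (add : ∀ x ∈ mulIdeal J I, ∀ y ∈ mulIdeal J I, p x → p y → p (x + y))
    (neg : ∀ x ∈ mulIdeal J I, p x → p (-x)) {z : R} (hz : z ∈ mulIdeal J I) : p z := by
  have hz' := (TwoSidedIdeal.mem_mk' _ _ _ _ _ _ _).1 hz
  simp only [SetLike.mem_coe] at hz'
  clear hz
  induction hz' using AddSubgroup.closure_induction with
  | mem z hz => obtain ⟨x, hx, y, hy, rfl⟩ := hz; exact mul x hx y hy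
  | zero => exact zero
  | add a b ha hb iha ihb =>
    exact add a ((TwoSidedIdeal.mem_mk' _ _ _ _ _ _ _).2 ha) b
      ((TwoSidedIdeal.mem_mk' _ _ _ _ _ _ _).2 hb) iha ihb
  | neg a ha iha => exact neg a ((TwoSidedIdeal.mem_mk' _ _ _ _ _ _ _).2 ha) iha

theorem mulIdeal_le_left (J I : TwoSidedIdeal R) : mulIdeal J I ≤ J := fun _ hz =>
  mulIdeal_induction (p := (· ∈ J)) (fun _ hx _ _ => J.mul_mem_right _ _ hx) J.zero_mem
    (fun _ _ _ _ => J.add_mem) (fun _ _ => J.neg_mem) hz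

theorem mulIdeal_le_right (J I : TwoSidedIdeal R) : mulIdeal J I ≤ I := fun _ hz =>
  mulIdeal_induction (p := (· ∈ I)) (fun _ _ _ hy => I.mul_mem_left _ _ hy) I.zero_mem
    (fun _ _ _ _ => I.add_mem) (fun _ _ => I.neg_mem) hz

theorem mulIdeal_mono {J J' I I' : TwoSidedIdeal R} (hJ : J ≤ J') (hI : I ≤ I') :
    mulIdeal J I ≤ mulIdeal J' I' := fun _ hz =>
  mulIdeal_induction (p := (· ∈ mulIdeal J' I'))
    (fun _ hx _ hy => mul_mem_mulIdeal (hJ hx) (hI hy)) (TwoSidedIdeal.zero_mem _)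
    (fun _ _ _ _ => TwoSidedIdeal.add_mem _) (fun _ _ => TwoSidedIdeal.neg_mem _) hz

theorem exists_mem_ne_zero {I : TwoSidedIdeal R} (hI : I ≠ ⊥) : ∃ x ∈ I, x ≠ 0 := by
  by_contra! h
  exact hI (le_antisymm (fun x hx => (TwoSidedIdeal.mem_bot R).2 (h x hx)) bot_le)

/-! ### The symmetric Martindale ring of quotients -/

/-- A partially defined symmetric multiplier of `R`: a nonzero ideal `dom`, a right `R`-module
homomorphism `l : dom → R` and a left `R`-module homomorphism `r : dom → R` with
`x (l y) = (r x) y` on `dom`. It stands for the element `q` with `q x = l x` and `x q = r x` for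
`x ∈ dom`. The maps are written as total functions whose values outside `dom` are irrelevant
(they are forgotten by `SymMul.setoid`). -/
structure SymMul (R : Type*) [NonUnitalRing R] where
  dom : TwoSidedIdeal R
  dom_ne : dom ≠ ⊥
  l : R → R
  r : R → R
  l_add : ∀ x ∈ dom, ∀ y ∈ dom, l (x + y) = l x + l y
  r_add : ∀ x ∈ dom, ∀ y ∈ dom, r (x + y) = r x + r y
  l_mul : ∀ x ∈ dom, ∀ a : R, l (x * a) = l x * a
  r_mul : ∀ x ∈ dom, ∀ a : R, r (a * x) = a * r x
  balanced : ∀ x ∈ dom, ∀ y ∈ dom, x * l y = r x * y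

namespace SymMul

theorem l_zero (q : SymMul R) : q.l 0 = 0 := by
  simpa using q.l_add 0 q.dom.zero_mem 0 q.dom.zero_mem

theorem r_zero (q : SymMul R) : q.r 0 = 0 := by
  simpa using q.r_add 0 q.dom.zero_mem 0 q.dom.zero_mem

theorem l_neg (q : SymMul R) {x : R} (hx : x ∈ q.dom) : q.l (-x) = -q.l x := by
  have h := q.l_add x hx (-x) (q.dom.neg_mem hx)
  rw [add_neg_cancel, l_zero] at h
  exact (neg_eq_of_add_eq_zero_right h.symm).symm

theorem r_neg (q : SymMul R) {x : R} (hx : x ∈ q.dom) : q.r (-x) = -q.r x := by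
  have h := q.r_add x hx (-x) (q.dom.neg_mem hx)
  rw [add_neg_cancel, r_zero] at h
  exact (neg_eq_of_add_eq_zero_right h.symm).symm

theorem l_mem (q : SymMul R) {J I : TwoSidedIdeal R} (hJ : J ≤ q.dom) {x : R}
    (hx : x ∈ mulIdeal J I) : q.l x ∈ I := by
  have hd : mulIdeal J I ≤ q.dom := (mulIdeal_le_left J I).trans hJ
  refine mulIdeal_induction (p := fun x => q.l x ∈ I) ?_ ?_ ?_ ?_ hx
  · intro x hx y hy
    rw [q.l_mul x (hJ hx)]
    exact I.mul_mem_left _ _ hy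
  · rw [q.l_zero]; exact I.zero_mem
  · intro x hx y hy h1 h2
    rw [q.l_add x (hd hx) y (hd hy)]
    exact I.add_mem h1 h2
  · intro x hx h1
    rw [q.l_neg (hd hx)]
    exact I.neg_mem h1

theorem r_mem (q : SymMul R) {J I : TwoSidedIdeal R} (hI : I ≤ q.dom) {x : R}
    (hx : x ∈ mulIdeal J I) : q.r x ∈ J := by
  have hd : mulIdeal J I ≤ q.dom := (mulIdeal_le_right J I).trans hI
  refine mulIdeal_induction (p := fun x => q.r x ∈ J) ?_ ?_ ?_ ?_ hx
  · intro x hx y hy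
    rw [q.r_mul y (hI hy)]
    exact J.mul_mem_right _ _ hx
  · rw [q.r_zero]; exact J.zero_mem
  · intro x hx y hy h1 h2
    rw [q.r_add x (hd hx) y (hd hy)]
    exact J.add_mem h1 h2
  · intro x hx h1
    rw [q.r_neg (hd hx)]
    exact J.neg_mem h1

/-- Two partial multipliers are identified if they agree on some nonzero ideal contained in both
domains. -/
def Rel (p q : SymMul R) : Prop :=
  ∃ K : TwoSidedIdeal R, K ≠ ⊥ ∧ K ≤ p.dom ∧ K ≤ q.dom ∧
    ∀ x ∈ K, p.l x = q.l x ∧ p.r x = q.r x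

/-- The negative of a partial multiplier. -/
def neg (p : SymMul R) : SymMul R where
  dom := p.dom
  dom_ne := p.dom_ne
  l x := -p.l x
  r x := -p.r x
  l_add x hx y hy := by rw [p.l_add x hx y hy, neg_add]
  r_add x hx y hy := by rw [p.r_add x hx y hy, neg_add]
  l_mul x hx a := by rw [p.l_mul x hx, neg_mul]
  r_mul x hx a := by rw [p.r_mul x hx, mul_neg]
  balanced x hx y hy := by rw [mul_neg, neg_mul, p.balanced x hx y hy]

theorem neg_congr {p p' : SymMul R} (hp : Rel p p') : Rel (neg p) (neg p') := by
  obtain ⟨K, h0, h1, h2, h⟩ := hp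
  exact ⟨K, h0, h1, h2, fun x hx => ⟨congrArg Neg.neg (h x hx).1, congrArg Neg.neg (h x hx).2⟩⟩

end SymMul

variable [IsPrimeRing R]

theorem mulIdeal_ne_bot {J I : TwoSidedIdeal R} (hJ : J ≠ ⊥) (hI : I ≠ ⊥) :
    mulIdeal J I ≠ ⊥ := by
  intro h
  obtain ⟨a, ha, ha0⟩ := exists_mem_ne_zero hJ
  obtain ⟨b, hb, hb0⟩ := exists_mem_ne_zero hI
  rcases IsPrimeRing.eq_zero_or_eq_zero a b (fun r =>
    (TwoSidedIdeal.mem_bot R).1 (h ▸ mul_mem_mulIdeal (J.mul_mem_right a r ha) hb)) with h | h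
  exacts [ha0 h, hb0 h]

theorem inf_ne_bot {J I : TwoSidedIdeal R} (hJ : J ≠ ⊥) (hI : I ≠ ⊥) : J ⊓ I ≠ ⊥ := fun h =>
  mulIdeal_ne_bot hJ hI
    (le_bot_iff.1 (h ▸ le_inf (mulIdeal_le_left J I) (mulIdeal_le_right J I)))

theorem top_ne_bot' : (⊤ : TwoSidedIdeal R) ≠ ⊥ := by
  intro h
  obtain ⟨x, hx⟩ := exists_ne (0 : R)
  exact hx ((TwoSidedIdeal.mem_bot R).1 (h ▸ (TwoSidedIdeal.mem_top R : x ∈ ⊤)))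

namespace SymMul

variable (R) in
instance setoid : Setoid (SymMul R) where
  r := Rel
  iseqv :=
    { refl := fun p => ⟨p.dom, p.dom_ne, le_rfl, le_rfl, fun _ _ => ⟨rfl, rfl⟩⟩
      symm := fun ⟨K, h0, h1, h2, h⟩ =>
        ⟨K, h0, h2, h1, fun x hx => ⟨(h x hx).1.symm, (h x hx).2.symm⟩⟩
      trans := fun ⟨K, h0, h1, _, h⟩ ⟨K', h0', _, h2', h'⟩ =>
        ⟨K ⊓ K', inf_ne_bot h0 h0', inf_le_left.trans h1, inf_le_right.trans h2', fun x hx =>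
          have hx' := (TwoSidedIdeal.mem_inf R).1 hx
          ⟨(h x hx'.1).1.trans (h' x hx'.2).1, (h x hx'.1).2.trans (h' x hx'.2).2⟩⟩ }

/-- Left and right multiplication by an element of `R`. -/
def ofRing (a : R) : SymMul R where
  dom := ⊤
  dom_ne := top_ne_bot'
  l x := a * x
  r x := x * a
  l_add _ _ _ _ := mul_add _ _ _
  r_add _ _ _ _ := add_mul _ _ _
  l_mul _ _ _ := (mul_assoc _ _ _).symm
  r_mul _ _ _ := mul_assoc _ _ _
  balanced _ _ _ _ := (mul_assoc _ _ _).symm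

/-- The identity multiplier. -/
def one : SymMul R where
  dom := ⊤
  dom_ne := top_ne_bot'
  l x := x
  r x := x
  l_add _ _ _ _ := rfl
  r_add _ _ _ _ := rfl
  l_mul _ _ _ := rfl
  r_mul _ _ _ := rfl
  balanced _ _ _ _ := rfl

/-- The sum of two partial multipliers. -/
def add (p q : SymMul R) : SymMul R where
  dom := p.dom ⊓ q.dom
  dom_ne := inf_ne_bot p.dom_ne q.dom_ne
  l x := p.l x + q.l x
  r x := p.r x + q.r x
  l_add x hx y hy := by
    have hx := (TwoSidedIdeal.mem_inf R).1 hx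
    have hy := (TwoSidedIdeal.mem_inf R).1 hy
    rw [p.l_add x hx.1 y hy.1, q.l_add x hx.2 y hy.2, add_add_add_comm]
  r_add x hx y hy := by
    have hx := (TwoSidedIdeal.mem_inf R).1 hx
    have hy := (TwoSidedIdeal.mem_inf R).1 hy
    rw [p.r_add x hx.1 y hy.1, q.r_add x hx.2 y hy.2, add_add_add_comm]
  l_mul x hx a := by
    have hx := (TwoSidedIdeal.mem_inf R).1 hx
    rw [p.l_mul x hx.1, q.l_mul x hx.2, add_mul]
  r_mul x hx a := by
    have hx := (TwoSidedIdeal.mem_inf R).1 hx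
    rw [p.r_mul x hx.1, q.r_mul x hx.2, mul_add]
  balanced x hx y hy := by
    have hx := (TwoSidedIdeal.mem_inf R).1 hx
    have hy := (TwoSidedIdeal.mem_inf R).1 hy
    rw [mul_add, add_mul, p.balanced x hx.1 y hy.1, q.balanced x hx.2 y hy.2]

/-- The product of two partial multipliers: `(p q) x = p (q x)` and `x (p q) = (x p) q`. -/
def mul (p q : SymMul R) : SymMul R where
  dom := mulIdeal q.dom p.dom
  dom_ne := mulIdeal_ne_bot q.dom_ne p.dom_ne
  l x := p.l (q.l x)
  r x := q.r (p.r x)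
  l_add x hx y hy := by
    rw [q.l_add x (mulIdeal_le_left _ _ hx) y (mulIdeal_le_left _ _ hy),
      p.l_add _ (q.l_mem le_rfl hx) _ (q.l_mem le_rfl hy)]
  r_add x hx y hy := by
    rw [p.r_add x (mulIdeal_le_right _ _ hx) y (mulIdeal_le_right _ _ hy),
      q.r_add _ (p.r_mem le_rfl hx) _ (p.r_mem le_rfl hy)]
  l_mul x hx a := by
    rw [q.l_mul x (mulIdeal_le_left _ _ hx), p.l_mul _ (q.l_mem le_rfl hx)]
  r_mul x hx a := by
    rw [p.r_mul x (mulIdeal_le_right _ _ hx), q.r_mul _ (p.r_mem le_rfl hx)]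
  balanced x hx y hy := by
    rw [p.balanced x (mulIdeal_le_right _ _ hx) _ (q.l_mem le_rfl hy),
      q.balanced _ (p.r_mem le_rfl hx) y (mulIdeal_le_left _ _ hy)]

theorem add_congr {p p' q q' : SymMul R} (hp : Rel p p') (hq : Rel q q') :
    Rel (add p q) (add p' q') := by
  obtain ⟨K, h0, h1, h2, h⟩ := hp
  obtain ⟨K', h0', h1', h2', h'⟩ := hq
  refine ⟨K ⊓ K', inf_ne_bot h0 h0', inf_le_inf h1 h1', inf_le_inf h2 h2', fun x hx => ?_⟩
  have hx := (TwoSidedIdeal.mem_inf R).1 hx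
  exact ⟨congrArg₂ (· + ·) (h x hx.1).1 (h' x hx.2).1,
    congrArg₂ (· + ·) (h x hx.1).2 (h' x hx.2).2⟩

theorem mul_congr {p p' q q' : SymMul R} (hp : Rel p p') (hq : Rel q q') :
    Rel (mul p q) (mul p' q') := by
  obtain ⟨K, h0, h1, h2, h⟩ := hp
  obtain ⟨K', h0', h1', h2', h'⟩ := hq
  refine ⟨mulIdeal K' K, mulIdeal_ne_bot h0' h0, mulIdeal_mono h1' h1, mulIdeal_mono h2' h2,
    fun x hx => ⟨?_, ?_⟩⟩
  · change p.l (q.l x) = p'.l (q'.l x)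
    rw [(h _ (q.l_mem h1' hx)).1, (h' x (mulIdeal_le_left _ _ hx)).1]
  · change q.r (p.r x) = q'.r (p'.r x)
    rw [(h' _ (p.r_mem h1 hx)).2, (h x (mulIdeal_le_right _ _ hx)).2]

/-- Multipliers that agree on both domains are identified. -/
theorem rel_of_forall {p q : SymMul R}
    (h : ∀ x ∈ p.dom, x ∈ q.dom → p.l x = q.l x ∧ p.r x = q.r x) : Rel p q :=
  ⟨p.dom ⊓ q.dom, inf_ne_bot p.dom_ne q.dom_ne, inf_le_left, inf_le_right, fun x hx =>
    h x ((TwoSidedIdeal.mem_inf R).1 hx).1 ((TwoSidedIdeal.mem_inf R).1 hx).2⟩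

end SymMul

variable (R) in
/-- The symmetric Martindale ring of quotients `Q_s(R)` of a prime ring `R`. -/
def Qs : Type _ := Quotient (SymMul.setoid R)

namespace Qs

/-- The class of a partial multiplier. -/
def mk (p : SymMul R) : Qs R := Quotient.mk (SymMul.setoid R) p

instance : Zero (Qs R) := ⟨mk (SymMul.ofRing 0)⟩

instance : One (Qs R) := ⟨mk SymMul.one⟩

instance : Add (Qs R) := ⟨Quotient.map₂ SymMul.add fun _ _ hp _ _ hq => SymMul.add_congr hp hq⟩

instance : Neg (Qs R) := ⟨Quotient.map SymMul.neg fun _ _ hp => SymMul.neg_congr hp⟩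

instance : Mul (Qs R) := ⟨Quotient.map₂ SymMul.mul fun _ _ hp _ _ hq => SymMul.mul_congr hp hq⟩

theorem mk_eq {p q : SymMul R}
    (h : ∀ x ∈ p.dom, x ∈ q.dom → p.l x = q.l x ∧ p.r x = q.r x) : mk p = mk q :=
  Quotient.sound (SymMul.rel_of_forall h)

instance : Ring (Qs R) where
  add_assoc := by
    rintro ⟨p⟩ ⟨q⟩ ⟨s⟩
    exact mk_eq fun x _ _ => ⟨add_assoc _ _ _, add_assoc _ _ _⟩
  zero_add := by
    rintro ⟨p⟩
    refine mk_eq fun x _ _ => ⟨?_, ?_⟩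
    · change 0 * x + p.l x = p.l x
      rw [zero_mul, zero_add]
    · change x * 0 + p.r x = p.r x
      rw [mul_zero, zero_add]
  add_zero := by
    rintro ⟨p⟩
    refine mk_eq fun x _ _ => ⟨?_, ?_⟩
    · change p.l x + 0 * x = p.l x
      rw [zero_mul, add_zero]
    · change p.r x + x * 0 = p.r x
      rw [mul_zero, add_zero]
  add_comm := by
    rintro ⟨p⟩ ⟨q⟩
    exact mk_eq fun x _ _ => ⟨add_comm _ _, add_comm _ _⟩
  neg_add_cancel := by
    rintro ⟨p⟩
    refine mk_eq fun x _ _ => ⟨?_, ?_⟩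
    · change -p.l x + p.l x = 0 * x
      rw [zero_mul, neg_add_cancel]
    · change -p.r x + p.r x = x * 0
      rw [mul_zero, neg_add_cancel]
  mul_assoc := by
    rintro ⟨p⟩ ⟨q⟩ ⟨s⟩
    exact mk_eq fun x _ _ => ⟨rfl, rfl⟩
  one_mul := by
    rintro ⟨p⟩
    exact mk_eq fun x _ _ => ⟨rfl, rfl⟩
  mul_one := by
    rintro ⟨p⟩
    exact mk_eq fun x _ _ => ⟨rfl, rfl⟩
  zero_mul := by
    rintro ⟨p⟩
    refine mk_eq fun x hx _ => ⟨?_, ?_⟩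
    · change 0 * p.l x = 0 * x
      rw [zero_mul, zero_mul]
    · change p.r (x * 0) = x * 0
      rw [mul_zero, p.r_zero]
  mul_zero := by
    rintro ⟨p⟩
    refine mk_eq fun x hx _ => ⟨?_, ?_⟩
    · change p.l (0 * x) = 0 * x
      rw [zero_mul, p.l_zero]
    · change p.r x * 0 = x * 0
      rw [mul_zero, mul_zero]
  left_distrib := by
    rintro ⟨p⟩ ⟨q⟩ ⟨s⟩
    refine mk_eq fun x h1 h2 => ⟨?_, rfl⟩
    have h2 := (TwoSidedIdeal.mem_inf R).1 h2
    exact p.l_add _ (q.l_mem le_rfl h2.1) _ (s.l_mem le_rfl h2.2)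
  right_distrib := by
    rintro ⟨p⟩ ⟨q⟩ ⟨s⟩
    refine mk_eq fun x h1 h2 => ⟨rfl, ?_⟩
    have h2 := (TwoSidedIdeal.mem_inf R).1 h2
    exact s.r_add _ (p.r_mem le_rfl h2.1) _ (q.r_mem le_rfl h2.2)
  nsmul := nsmulRec
  zsmul := zsmulRec

variable (R) in
/-- The canonical embedding of `R` into `Q_s(R)`. -/
def ofRing : R →ₙ+* Qs R where
  toFun a := mk (SymMul.ofRing a)
  map_zero' := rfl
  map_add' _ _ := mk_eq fun _ _ _ => ⟨add_mul _ _ _, mul_add _ _ _⟩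
  map_mul' _ _ := mk_eq fun _ _ _ => ⟨mul_assoc _ _ _, (mul_assoc _ _ _).symm⟩

end Qs

variable (R) in
/-- The extended centroid `C` of `R`: the center of `Q_s(R)`. -/
abbrev extendedCentroid : Subring (Qs R) := Subring.center (Qs R)

/-- `A C`: the additive subgroup of `Q_s(R)` generated by all products `a c` with `a ∈ A`,
`c ∈ C`, that is, the `C`-subspace of `Q_s(R)` spanned by `A`. -/
def extend (A : Set R) : Submodule (extendedCentroid R) (Qs R) :=
  Submodule.span (extendedCentroid R) (Qs.ofRing R '' A)

variable (R) in
/-- The central closure `R C`. -/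
def centralClosure : Submodule (extendedCentroid R) (Qs R) := extend (Set.univ : Set R)

end Martindale

/-! ### Lie ideals and their products -/

/-- An additive subgroup `L` of `R` is a Lie ideal if `[L, R] ⊆ L`. -/
def IsLieIdeal {R : Type*} [NonUnitalRing R] (L : AddSubgroup R) : Prop :=
  ∀ a ∈ L, ∀ r : R, a * r - r * a ∈ L

open scoped Pointwise in
/-- The product `K₀ K₁ ⋯ K_m` of `m + 1` additive subgroups, where `A B` is the additive subgroup
generated by all `a b` with `a ∈ A`, `b ∈ B`. -/
def prodSubgroups {R : Type*} [NonUnitalRing R] :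
    (m : ℕ) → (Fin (m + 1) → AddSubgroup R) → AddSubgroup R
  | 0, K => K 0
  | m + 1, K => prodSubgroups m (fun i => K i.castSucc) * K (Fin.last (m + 1))

/-! By the Leibniz rule a product of Lie ideals is again a Lie ideal, and a product of noncentral
ones is noncentral (`not_mul_subset_center`). So let `P` be the full product, and suppose some
noncentral `x` in `R` centralizes it.

The engine is a Posner-type argument. If a noncentral `y` centralizes a noncentral Lie ideal `K`,
then for each noncentral `k` in `K` the Jacobi identity makes the composite of the inner derivations
of `k` and `y` vanish. Martindale's lemma then forces characteristic 2, `y ^ 2 ∈ C` and `k ∈ C + C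
y`; with a little more work, `K C = C + C y` (`extend_eq_span_of_commute`).

It remains to pass from `P` to its factors: `commute_of_commute_mul_lieIdeal` does this for two
factors, and induction for the rest. Hence every `K_j C` equals `C + C x`, of dimension 2. A
noncentral `y` centralizing `P` satisfies `C + C y = P C = C + C x`, so the centralizer is exactly
this plane. -/

namespace Martindale

variable {R : Type*} [NonUnitalRing R] [IsPrimeRing R]

/-! ### Primeness of `Q_s(R)` and the extended centroid -/

namespace Qs

theorem mk_mul_ofRing (p : SymMul R) {x : R} (hx : x ∈ p.dom) :
    mk p * ofRing R x = ofRing R (p.l x) := by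
  refine mk_eq fun y hy _ => ⟨p.l_mul x hx y, ?_⟩
  exact (p.balanced y (mulIdeal_le_right _ _ hy) x hx).symm

theorem exists_ideal_mul_ofRing (q : Qs R) :
    ∃ I : TwoSidedIdeal R, I ≠ ⊥ ∧ ∀ x ∈ I, ∃ y, q * ofRing R x = ofRing R y := by
  obtain ⟨p⟩ := q
  exact ⟨p.dom, p.dom_ne, fun x hx => ⟨_, mk_mul_ofRing p hx⟩⟩

theorem ofRing_injective : Function.Injective (ofRing R) := by
  refine (injective_iff_map_eq_zero _).2 fun a ha => ?_
  obtain ⟨K, hK, -, -, h⟩ := Quotient.exact (s := SymMul.setoid R) ha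
  obtain ⟨k, hk, hk0⟩ := exists_mem_ne_zero hK
  refine (IsPrimeRing.eq_zero_or_eq_zero a k fun r => ?_).resolve_right hk0
  have := (h (r * k) (K.mul_mem_left _ _ hk)).1
  change a * (r * k) = 0 * (r * k) at this
  rw [mul_assoc, this, zero_mul]

theorem ofRing_eq_zero {a : R} : ofRing R a = 0 ↔ a = 0 :=
  map_eq_zero_iff _ ofRing_injective

/-- The left map of a representative vanishes on a nonzero ideal by assumption. Balancedness turns
this into `(p.r x) r k = 0` for a fixed nonzero `k`, so primeness kills the right map too. -/
theorem eq_zero_of_mul_ofRing {q : Qs R} {I : TwoSidedIdeal R} (hI : I ≠ ⊥)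
    (h : ∀ x ∈ I, q * ofRing R x = 0) : q = 0 := by
  obtain ⟨p⟩ := q
  have hJ := inf_ne_bot hI p.dom_ne
  have hl : ∀ x ∈ I ⊓ p.dom, p.l x = 0 := fun x hx => by
    have hx := (TwoSidedIdeal.mem_inf R).1 hx
    rw [← ofRing_eq_zero, ← mk_mul_ofRing p hx.2]
    exact h x hx.1
  obtain ⟨k, hk, hk0⟩ := exists_mem_ne_zero hJ
  refine Quotient.sound ⟨I ⊓ p.dom, hJ, inf_le_right, le_top, fun x hx => ⟨?_, ?_⟩⟩
  · change p.l x = 0 * x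
    rw [hl x hx, zero_mul]
  · change p.r x = x * 0
    rw [mul_zero]
    refine (IsPrimeRing.eq_zero_or_eq_zero _ k fun r => ?_).resolve_right hk0
    have hrk := (I ⊓ p.dom).mul_mem_left r _ hk
    rw [mul_assoc, ← p.balanced x ((TwoSidedIdeal.mem_inf R).1 hx).2 _
      ((TwoSidedIdeal.mem_inf R).1 hrk).2, hl _ hrk, mul_zero]

theorem exists_mul_ofRing_ne_zero {q : Qs R} (hq : q ≠ 0) {I : TwoSidedIdeal R} (hI : I ≠ ⊥) :
    ∃ x ∈ I, q * ofRing R x ≠ 0 := by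
  by_contra! h
  exact hq (eq_zero_of_mul_ofRing hI h)

/-- Clearing denominators on the right by `i` and `j` moves the question to the nonzero elements `p
i` and `q j` of `R`. -/
theorem eq_zero_or_eq_zero {p q : Qs R} (h : ∀ r, p * ofRing R r * q = 0) : p = 0 ∨ q = 0 := by
  by_contra! hpq
  obtain ⟨I, hI, hpI⟩ := exists_ideal_mul_ofRing p
  obtain ⟨J, hJ, hqJ⟩ := exists_ideal_mul_ofRing q
  obtain ⟨i, hi, hpi⟩ := exists_mul_ofRing_ne_zero hpq.1 hI
  obtain ⟨j, hj, hqj⟩ := exists_mul_ofRing_ne_zero hpq.2 hJ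
  obtain ⟨u, hu⟩ := hpI i hi
  obtain ⟨v, hv⟩ := hqJ j hj
  rw [hu, Ne, ofRing_eq_zero] at hpi
  rw [hv, Ne, ofRing_eq_zero] at hqj
  refine (IsPrimeRing.eq_zero_or_eq_zero u v fun r => ofRing_injective ?_).elim hpi hqj
  have := h (i * r)
  rw [map_mul] at this
  rw [map_mul, map_mul, ← hu, ← hv, map_zero]
  calc _ = (p * (ofRing R i * ofRing R r) * q) * ofRing R j := by simp only [mul_assoc]
    _ = 0 := by rw [this, zero_mul]

theorem mem_extendedCentroid {q : Qs R} (h : ∀ r, q * ofRing R r = ofRing R r * q) :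
    q ∈ extendedCentroid R := by
  refine Subring.mem_center_iff.2 fun p => ?_
  obtain ⟨I, hI, hpI⟩ := exists_ideal_mul_ofRing p
  rw [← sub_eq_zero]
  refine eq_zero_of_mul_ofRing hI fun x hx => ?_
  obtain ⟨y, hy⟩ := hpI x hx
  rw [sub_mul, mul_assoc, mul_assoc, hy, h, h, ← mul_assoc, hy, sub_self]

theorem exists_commutator_ne_zero {q : Qs R} (h : q ∉ extendedCentroid R) :
    ∃ r, q * ofRing R r - ofRing R r * q ≠ 0 := by
  by_contra! h'
  exact h (mem_extendedCentroid fun r => sub_eq_zero.1 (h' r))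

/-- Martindale's lemma. -/
theorem exists_smul_eq_of_mul_mul_eq {a b c d : Qs R} (ha : a ≠ 0) (hd : d ≠ 0)
    (h : ∀ r, a * ofRing R r * b = c * ofRing R r * d) :
    ∃ k : extendedCentroid R, c = k • a ∧ b = k • d := by
  have huniq : ∀ w w' : Qs R, (∀ r, a * ofRing R r * w = a * ofRing R r * w') → w = w' :=
    fun w w' hw => sub_eq_zero.1 <| (eq_zero_or_eq_zero fun r => by
      rw [mul_sub, hw, sub_self]).resolve_left ha
  -- The sought `k` should satisfy `c = k a`, so `a r w = c r z` says `w = k z`. `D` collects the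
  -- `z` in `R` for which `k z` lies in `R`; it is nonzero because it contains `d i` whenever `b i`
  -- and `d i` are both in `R`.
  let D : TwoSidedIdeal R := TwoSidedIdeal.mk'
    {z | ∃ w, ∀ r, a * ofRing R r * ofRing R w = c * ofRing R r * ofRing R z}
    ⟨0, fun r => by simp⟩
    (fun {x y} ⟨w, hw⟩ ⟨w', hw'⟩ => ⟨w + w', fun r => by simp only [map_add, mul_add, hw, hw']⟩)
    (fun {x} ⟨w, hw⟩ => ⟨-w, fun r => by simp only [map_neg, mul_neg, hw]⟩)
    (fun {x y} ⟨w, hw⟩ => ⟨x * w, fun r => by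
      have := hw (r * x)
      simp only [map_mul, mul_assoc] at this ⊢
      exact this⟩)
    (fun {x y} ⟨w, hw⟩ => ⟨w * y, fun r => by
      rw [map_mul, map_mul, ← mul_assoc, ← mul_assoc, hw]⟩)
  have hD : ∀ z, z ∈ D ↔ ∃ w, ∀ r, a * ofRing R r * ofRing R w = c * ofRing R r * ofRing R z :=
    fun z => TwoSidedIdeal.mem_mk' _ _ _ _ _ _ _
  obtain ⟨I, hI, hbI⟩ := exists_ideal_mul_ofRing b
  obtain ⟨J, hJ, hdJ⟩ := exists_ideal_mul_ofRing d
  have hbd : ∀ i ∈ I ⊓ J, ∃ v w, b * ofRing R i = ofRing R w ∧ d * ofRing R i = ofRing R v ∧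
      ∀ r, a * ofRing R r * ofRing R w = c * ofRing R r * ofRing R v := fun i hi => by
    have hi := (TwoSidedIdeal.mem_inf R).1 hi
    obtain ⟨w, hw⟩ := hbI i hi.1
    obtain ⟨v, hv⟩ := hdJ i hi.2
    refine ⟨v, w, hw, hv, fun r => ?_⟩
    rw [← hw, ← hv, ← mul_assoc, ← mul_assoc, h]
  have hD0 : D ≠ ⊥ := by
    obtain ⟨i, hi, hi0⟩ := exists_mul_ofRing_ne_zero hd (inf_ne_bot hI hJ)
    obtain ⟨v, w, -, hv, hvw⟩ := hbd i hi
    intro hbot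
    have hvD : v ∈ D := (hD v).2 ⟨w, hvw⟩
    rw [hbot, TwoSidedIdeal.mem_bot] at hvD
    rw [hv, hvD, map_zero] at hi0
    exact hi0 rfl
  choose! f hf using fun z (hz : z ∈ D) => (hD z).1 hz
  have hf' : ∀ z ∈ D, ∀ w, (∀ r, a * ofRing R r * ofRing R w = c * ofRing R r * ofRing R z) →
      f z = w := fun z hz w hw =>
    ofRing_injective (huniq _ _ fun r => by rw [hf z hz, hw])
  have hadd : ∀ x ∈ D, ∀ y ∈ D, f (x + y) = f x + f y := fun x hx y hy =>
    hf' _ (D.add_mem hx hy) _ fun r => by simp only [map_add, mul_add, hf x hx, hf y hy]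
  have hmulr : ∀ x ∈ D, ∀ t, f (x * t) = f x * t := fun x hx t =>
    hf' _ (D.mul_mem_right _ _ hx) _ fun r => by
      rw [map_mul, map_mul, ← mul_assoc, ← mul_assoc, hf x hx]
  have hmull : ∀ x ∈ D, ∀ t, f (t * x) = t * f x := fun x hx t =>
    hf' _ (D.mul_mem_left _ _ hx) _ fun r => by
      have := hf x hx (r * t)
      simp only [map_mul, mul_assoc] at this ⊢
      exact this
  -- Being a bimodule map, `f` can serve on both sides, which makes its class central.
  let k : SymMul R :=
    { dom := D, dom_ne := hD0, l := f, r := f, l_add := hadd, r_add := hadd, l_mul := hmulr,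
      r_mul := hmull
      balanced := fun x hx y hy => by rw [← hmull y hy, hmulr x hx] }
  have hk : mk k ∈ extendedCentroid R := mem_extendedCentroid fun r => by
    rw [← sub_eq_zero]
    refine eq_zero_of_mul_ofRing hD0 fun x hx => ?_
    rw [sub_mul, mul_assoc, mul_assoc, mk_mul_ofRing k hx, ← map_mul,
      mk_mul_ofRing k (D.mul_mem_left _ _ hx), ← map_mul, sub_eq_zero]
    exact congrArg _ (hmull x hx r)
  have hb : b = mk k * d := by
    rw [← sub_eq_zero]
    refine eq_zero_of_mul_ofRing (inf_ne_bot hI hJ) fun i hi => ?_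
    obtain ⟨v, w, hw, hv, hvw⟩ := hbd i hi
    have hvD : v ∈ D := (hD v).2 ⟨w, hvw⟩
    rw [sub_mul, mul_assoc, hv, hw, mk_mul_ofRing k hvD, sub_eq_zero]
    exact congrArg _ (hf' v hvD w hvw).symm
  refine ⟨⟨mk k, hk⟩, ?_, hb⟩
  change c = mk k * a
  rw [← sub_eq_zero]
  refine (eq_zero_or_eq_zero fun r => ?_).resolve_right hd
  have := h r
  rw [hb, ← mul_assoc, Subring.mem_center_iff.1 hk] at this
  rw [sub_mul, sub_mul, ← this, ← mul_assoc, sub_self]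

theorem ne_zero_of_notMem {q : Qs R} (h : q ∉ extendedCentroid R) : q ≠ 0 := by
  rintro rfl
  exact h (zero_mem _)

instance : Nontrivial (Qs R) := by
  obtain ⟨x, hx⟩ := exists_ne (0 : R)
  exact ⟨ofRing R x, 0, fun h => hx (ofRing_eq_zero.1 h)⟩

/-- Martindale's lemma applied to `k r 1 = 1 r k` provides the inverse; thus `C` is a field. -/
theorem exists_mul_eq_one {k : extendedCentroid R} (hk : k ≠ 0) :
    ∃ k' : extendedCentroid R, k' * k = 1 := by
  have hk' : (k : Qs R) ≠ 0 := fun h => hk (Subtype.ext h)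
  obtain ⟨k', h, -⟩ := exists_smul_eq_of_mul_mul_eq (a := (k : Qs R)) (b := 1) (c := 1)
    (d := (k : Qs R)) hk' hk' fun r => by
      rw [one_mul, mul_one, Subring.mem_center_iff.1 k.2]
  exact ⟨k', Subtype.ext h.symm⟩

theorem smul_mem_extendedCentroid (k : extendedCentroid R) {q : Qs R}
    (hq : q ∈ extendedCentroid R) : k • q ∈ extendedCentroid R :=
  mul_mem k.2 hq

theorem mem_extendedCentroid_of_smul {k : extendedCentroid R} (hk : k ≠ 0) {q : Qs R}
    (hq : k • q ∈ extendedCentroid R) : q ∈ extendedCentroid R := by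
  obtain ⟨k', h⟩ := exists_mul_eq_one hk
  have := smul_mem_extendedCentroid k' hq
  rwa [smul_smul, h, one_smul] at this

theorem eq_zero_of_smul_eq_zero {k : extendedCentroid R} {q : Qs R} (h : k • q = 0) :
    k = 0 ∨ q = 0 := by
  by_cases hk : k = 0
  · exact Or.inl hk
  obtain ⟨k', h'⟩ := exists_mul_eq_one hk
  right
  rw [← one_smul (extendedCentroid R) q, ← h', ← smul_smul, h, smul_zero]

end Qs

open Qs

/-! ### Inner derivations with zero composite, and centralizers of one Lie ideal -/

theorem span_pair_commute {x p q : Qs R} (hp : p ∈ Submodule.span (extendedCentroid R) {1, x})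
    (hq : q * x = x * q) : q * p = p * q := by
  obtain ⟨s, t, rfl⟩ := Submodule.mem_span_pair.1 hp
  simp only [mul_add, add_mul, mul_smul_comm, smul_mul_assoc, mul_one, one_mul, hq]

/-- If the inner derivations of `a` and `x` have composition zero on `R`, and neither is zero, then
the characteristic is two and the derivations are proportional. -/
theorem two_eq_zero_and_exists_smul_add {a x : Qs R} (ha : a ∉ extendedCentroid R)
    (hx : x ∉ extendedCentroid R) (hax : a * x = x * a)
    (h : ∀ r, a * (x * ofRing R r - ofRing R r * x) = (x * ofRing R r - ofRing R r * x) * a) :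
    (2 : Qs R) = 0 ∧ x * x ∈ extendedCentroid R ∧
      ∃ s t : extendedCentroid R, a = s • 1 + t • x := by
  set f : R → Qs R := fun r => a * ofRing R r - ofRing R r * a with hf
  set g : R → Qs R := fun r => x * ofRing R r - ofRing R r * x with hg
  have h' : ∀ r, a * g r = g r * a := h
  have hgf : ∀ r, x * f r = f r * x := fun r => by
    have h1 : x * f r - f r * x = a * g r - g r * a + (x * a - a * x) * ofRing R r
        - ofRing R r * (x * a - a * x) := by simp only [hf, hg]; noncomm_ring
    rw [← sub_eq_zero, h1, h', hax]; simp
  have hfm : ∀ r s, f (r * s) = f r * ofRing R s + ofRing R r * f s := fun r s => by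
    simp only [hf, map_mul]; noncomm_ring
  have hgm : ∀ r s, g (r * s) = g r * ofRing R s + ofRing R r * g s := fun r s => by
    simp only [hg, map_mul]; noncomm_ring
  -- Expand `[a, g (r s)] = 0` by Leibniz; the terms containing `[a, g r]` or `[a, g s]` vanish.
  have key : ∀ r s, f r * g s + g r * f s = 0 := fun r s => by
    have h1 := h (r * s)
    change a * g (r * s) = g (r * s) * a at h1
    rw [← sub_eq_zero] at h1
    calc f r * g s + g r * f s = a * g (r * s) - g (r * s) * a - (a * g r - g r * a) * ofRing R s
          - ofRing R r * (a * g s - g s * a) := by rw [hgm]; simp only [hf]; noncomm_ring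
      _ = 0 := by rw [h1, h' r, h' s]; simp
  have key' : ∀ r t s, f r * ofRing R t * g s = -(g r * ofRing R t * f s) := fun r t s => by
    have h1 := key (r * t) s
    rw [hfm, hgm] at h1
    rw [← sub_eq_zero]
    calc _ = (f r * ofRing R t + ofRing R r * f t) * g s + (g r * ofRing R t +
          ofRing R r * g t) * f s - ofRing R r * (f t * g s + g t * f s) := by noncomm_ring
      _ = 0 := by rw [h1, key]; simp
  obtain ⟨s, hs⟩ := exists_commutator_ne_zero hx
  change g s ≠ 0 at hs
  -- Both `f s` and `-f s` come out equal to `k • g s`, which is where characteristic 2 originates.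
  obtain ⟨k, hk1, hk2⟩ := exists_smul_eq_of_mul_mul_eq (a := g s) (b := -f s) (c := f s) (d := g s)
    hs hs fun r => by rw [key', mul_neg]
  have hfg : ∀ r, f r = -(k • g r) := fun r => by
    rw [← sub_eq_zero]
    refine (eq_zero_or_eq_zero fun t => ?_).resolve_right hs
    rw [sub_mul, sub_mul, key', hk1]
    simp
  have hk : k ≠ 0 := by
    rintro rfl
    exact ha (mem_extendedCentroid fun r => sub_eq_zero.1 (by simpa using hfg r))
  have h2 : (2 : Qs R) = 0 := by
    have : k • g s + k • g s = 0 := by nth_rewrite 1 [← hk2]; rw [← hk1, neg_add_cancel]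
    rw [← smul_add] at this
    have := (eq_zero_of_smul_eq_zero this).resolve_left hk
    refine (eq_zero_or_eq_zero fun r => ?_).resolve_right hs
    rw [mul_assoc, two_mul, ← mul_add, this, mul_zero]
  have hneg : ∀ q : Qs R, -q = q := fun q => by
    rw [neg_eq_iff_add_eq_zero, ← two_mul, h2, zero_mul]
  refine ⟨h2, mem_extendedCentroid fun r => ?_, ?_⟩
  · have h1 := hgf r
    rw [hfg, hneg, mul_smul_comm, smul_mul_assoc, ← sub_eq_zero, ← smul_sub] at h1
    have h3 := (eq_zero_of_smul_eq_zero h1).resolve_left hk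
    rw [← sub_eq_zero, ← h3]
    simp only [hg]
    -- In characteristic 2 the square of the inner derivation of `x` is the inner derivation of `x ^
    -- 2`.
    calc _ = x * (x * ofRing R r - ofRing R r * x) - (x * ofRing R r - ofRing R r * x) * x
          + 2 * (x * ofRing R r * x - ofRing R r * (x * x)) := by noncomm_ring
      _ = x * (x * ofRing R r - ofRing R r * x) - (x * ofRing R r - ofRing R r * x) * x := by
        rw [h2, zero_mul, add_zero]
  · have hc : a - k • x ∈ extendedCentroid R := mem_extendedCentroid fun r => by
      have := hfg r
      rw [hneg, ← sub_eq_zero] at this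
      rw [← sub_eq_zero, ← this]
      simp only [hf, hg, sub_mul, mul_sub, smul_sub, smul_mul_assoc, mul_smul_comm]
      abel
    refine ⟨⟨_, hc⟩, k, ?_⟩
    rw [Subring.smul_def, smul_eq_mul, mul_one]
    simp

theorem mul_self_mem_extendedCentroid {x : Qs R} (h2 : (2 : Qs R) = 0)
    (hx : x * x ∈ extendedCentroid R) (s t : extendedCentroid R) :
    (s • 1 + t • x) * (s • 1 + t • x) ∈ extendedCentroid R := by
  have : (s • 1 + t • x) * (s • 1 + t • x) =
      (s * s) • (1 : Qs R) + (t * t) • (x * x) + (s * t) • (2 * x) := by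
    simp only [mul_add, add_mul, mul_smul_comm, smul_mul_assoc, mul_one, one_mul, two_mul]
    module
  rw [this, h2, zero_mul, smul_zero, add_zero]
  exact add_mem (smul_mem_extendedCentroid _ (one_mem _)) (smul_mem_extendedCentroid _ hx)

theorem commutator_mem_extend {K : AddSubgroup R} (hK : IsLieIdeal K) {a : R} (ha : a ∈ K) (r : R) :
    ofRing R a * ofRing R r - ofRing R r * ofRing R a ∈ extend (K : Set R) :=
  Submodule.subset_span ⟨_, hK a ha r, by simp⟩

/-- A noncentral element centralizing a noncentral Lie ideal `K` generates `K C`. -/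
theorem extend_eq_span_of_commute {K : AddSubgroup R} (hK : IsLieIdeal K) {k₀ : R} (hk₀ : k₀ ∈ K)
    (hk₀C : ofRing R k₀ ∉ extendedCentroid R)
    {y : Qs R} (hy : y ∉ extendedCentroid R) (h : ∀ k ∈ K, y * ofRing R k = ofRing R k * y) :
    (2 : Qs R) = 0 ∧ y * y ∈ extendedCentroid R ∧
      extend (K : Set R) = Submodule.span (extendedCentroid R) {1, y} := by
  have hmain : ∀ k ∈ K, ofRing R k ∉ extendedCentroid R → (2 : Qs R) = 0 ∧
      y * y ∈ extendedCentroid R ∧ ∃ s t : extendedCentroid R, ofRing R k = s • 1 + t • y := by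
    intro k hk hkC
    -- Jacobi: `[k, [y, r]] = [y, [k, r]] - [[y, k], r]`, and `y` commutes with both `k` and `[k,
    -- r]`, which lie in `K`.
    refine two_eq_zero_and_exists_smul_add hkC hy (h k hk).symm fun r => ?_
    have h1 := h _ (hK k hk r)
    simp only [map_sub, map_mul] at h1
    have h2 := h k hk
    rw [← sub_eq_zero] at h1 h2 ⊢
    generalize ofRing R k = a at *
    generalize ofRing R r = b at *
    calc _ = y * (a * b - b * a) - (a * b - b * a) * y - ((y * a - a * y) * b
          - b * (y * a - a * y)) := by noncomm_ring
      _ = 0 := by rw [h1, h2]; simp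
  have hle : extend (K : Set R) ≤ Submodule.span (extendedCentroid R) {1, y} := by
    refine Submodule.span_le.2 ?_
    rintro _ ⟨k, hk, rfl⟩
    refine Submodule.mem_span_pair.2 ?_
    by_cases hkC : ofRing R k ∈ extendedCentroid R
    · exact ⟨⟨_, hkC⟩, 0, by rw [Subring.smul_def]; simp⟩
    · obtain ⟨-, -, s, t, hst⟩ := hmain k hk hkC
      exact ⟨s, t, hst.symm⟩
  obtain ⟨h2, hyy, s₀, t₀, hst₀⟩ := hmain k₀ hk₀ hk₀C
  refine ⟨h2, hyy, le_antisymm hle ?_⟩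
  have ht₀ : t₀ ≠ 0 := by
    rintro rfl
    rw [zero_smul, add_zero] at hst₀
    exact hk₀C (hst₀ ▸ smul_mem_extendedCentroid _ (one_mem _))
  obtain ⟨t', ht'⟩ := exists_mul_eq_one ht₀
  have hk₀E : ofRing R k₀ ∈ extend (K : Set R) := Submodule.subset_span ⟨k₀, hk₀, rfl⟩
  have hone : (1 : Qs R) ∈ extend (K : Set R) := by
    by_contra h1
    -- Inside `C + C y = C + C k₀`, a vector of `K C` with nonzero component along 1 would put 1
    -- into `K C`. So `K C` is the line `C k₀`, which contains every `[k₀, r]`.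
    have hb : ∀ r, ∃ b : extendedCentroid R,
        ofRing R k₀ * ofRing R r - ofRing R r * ofRing R k₀ = b • ofRing R k₀ := by
      intro r
      have hE := commutator_mem_extend hK hk₀ r
      obtain ⟨s, t, hst⟩ := Submodule.mem_span_pair.1 (hle hE)
      have hy' : y = t' • ofRing R k₀ - (t' * s₀) • 1 := by
        rw [hst₀, smul_add, smul_smul, smul_smul, ht', one_smul]; abel
      have hsub : (s - t * t' * s₀) • (1 : Qs R) ∈ extend (K : Set R) := by
        have : (s - t * t' * s₀) • (1 : Qs R) = (ofRing R k₀ * ofRing R r -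
            ofRing R r * ofRing R k₀) - (t * t') • ofRing R k₀ := by
          rw [← hst, hy']; module
        rw [this]
        exact sub_mem hE (Submodule.smul_mem _ _ hk₀E)
      have hz : s - t * t' * s₀ = 0 := by
        by_contra hne
        obtain ⟨u, hu⟩ := exists_mul_eq_one hne
        apply h1
        rw [← one_smul (extendedCentroid R) (1 : Qs R), ← hu, ← smul_smul]
        exact Submodule.smul_mem _ _ hsub
      refine ⟨t * t', ?_⟩
      have : (ofRing R k₀ * ofRing R r - ofRing R r * ofRing R k₀) - (t * t') • ofRing R k₀
          = (s - t * t' * s₀) • (1 : Qs R) := by rw [← hst, hy']; module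
      rwa [hz, zero_smul, sub_eq_zero] at this
    have hsq : ofRing R k₀ * ofRing R k₀ ∈ extendedCentroid R := by
      rw [hst₀]
      exact mul_self_mem_extendedCentroid h2 hyy _ _
    set a := ofRing R k₀ with ha
    by_cases hz : a * a = 0
    · refine ne_zero_of_notMem hk₀C ((eq_zero_or_eq_zero fun r => ?_).elim id id)
      obtain ⟨b, hb⟩ := hb r
      have : a * ofRing R r * a = a * a * ofRing R r -
        a * (a * ofRing R r - ofRing R r * a) := by noncomm_ring
      rw [this, hb, mul_smul_comm, hz]; simp
    · refine hk₀C (mem_extendedCentroid fun r => ?_)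
      obtain ⟨b, hbr⟩ := hb r
      -- Since `[k₀, r k₀] = [k₀, r] k₀ = b k₀ ^ 2` is central, its multiple form `c k₀` forces `c =
      -- 0`, and then `b = 0`.
      obtain ⟨c, hbc⟩ := hb (r * k₀)
      rw [map_mul, ← ha] at hbc
      have h3 : b • (a * a) = c • a := by
        rw [← hbc, ← smul_mul_assoc, ← hbr]; noncomm_ring
      have hc : c = 0 := by
        by_contra hc
        exact hk₀C (mem_extendedCentroid_of_smul hc (h3 ▸ smul_mem_extendedCentroid b hsq))
      rw [hc, zero_smul] at h3
      have hb0 := (eq_zero_of_smul_eq_zero h3).resolve_right hz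
      rw [← sub_eq_zero, hbr, hb0, zero_smul]
  refine Submodule.span_le.2 ?_
  refine Set.insert_subset hone (Set.singleton_subset_iff.2 ?_)
  · have : y = t' • ofRing R k₀ - (t' * s₀) • 1 := by
      rw [hst₀, smul_add, smul_smul, smul_smul, ht', one_smul]; abel
    rw [this]
    exact sub_mem (Submodule.smul_mem _ _ hk₀E) (Submodule.smul_mem _ _ hone)

/-! ### Products of noncentral Lie ideals -/

theorem mem_center_iff {x : R} : x ∈ Set.center R ↔ ofRing R x ∈ extendedCentroid R := by
  rw [Semigroup.mem_center_iff]
  refine ⟨fun h => mem_extendedCentroid fun r => by rw [← map_mul, ← map_mul, h],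
    fun h r => ofRing_injective ?_⟩
  rw [map_mul, map_mul, Subring.mem_center_iff.1 h]

theorem exists_notMem_extendedCentroid {K : AddSubgroup R} (hK : ¬ (K : Set R) ⊆ Set.center R) :
    ∃ k ∈ K, ofRing R k ∉ extendedCentroid R := by
  obtain ⟨k, hk, h⟩ := Set.not_subset.1 hK
  exact ⟨k, hk, fun h' => h (mem_center_iff.2 h')⟩

/-- If `[b, s]` is nonzero, it is invertible in `C`, while `[b, s b] = [b, s] b` is central too;
dividing shows `b` central. -/
theorem mem_extendedCentroid_of_commutator {b : R}
    (h : ∀ s, ofRing R b * ofRing R s - ofRing R s * ofRing R b ∈ extendedCentroid R) :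
    ofRing R b ∈ extendedCentroid R := by
  by_contra hb
  obtain ⟨s, hs⟩ := exists_commutator_ne_zero hb
  have h1 := h (s * b)
  set c : extendedCentroid R := ⟨_, h s⟩ with hc
  have hc0 : c ≠ 0 := fun h => hs (congrArg Subtype.val h)
  refine hb (mem_extendedCentroid_of_smul hc0 ?_)
  convert h1 using 1
  rw [Subring.smul_def, hc, smul_eq_mul, map_mul]
  noncomm_ring

/-- A product of two elements of noncentral Lie ideals cannot always be central. -/
theorem exists_mul_notMem_extendedCentroid {A B : AddSubgroup R} (hB : IsLieIdeal B)
    {a₀ b₀ : R} (ha₀ : a₀ ∈ A) (hb₀ : b₀ ∈ B)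
    (ha₀0 : a₀ ≠ 0) (hb₀C : ofRing R b₀ ∉ extendedCentroid R) :
    ∃ a ∈ A, ∃ b ∈ B, ofRing R a * ofRing R b ∉ extendedCentroid R := by
  by_contra! h
  have hz : ∀ a ∈ A, ∀ b ∈ B, ofRing R b ∉ extendedCentroid R →
      ofRing R a * ofRing R b = 0 := by
    intro a ha b hb hbC
    by_contra h0
    set z : extendedCentroid R := ⟨_, h a ha b hb⟩ with hz
    have hz0 : z ≠ 0 := fun h => h0 (congrArg Subtype.val h)
    refine hbC (mem_extendedCentroid_of_commutator fun s => mem_extendedCentroid_of_smul hz0 ?_)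
    -- `[b, b s] = b [b, s]` lies in `B`, so `(a b) [b, s]` is central, and the nonzero scalar `a b`
    -- can be cancelled.
    have h1 := h a ha _ (hB b hb (b * s))
    set p := ofRing R a * (ofRing R (b * (b * s) - b * s * b)) with hp
    have : z • (ofRing R b * ofRing R s - ofRing R s * ofRing R b) = p := by
      rw [Subring.smul_def, hz, smul_eq_mul, hp]
      simp only [map_sub, map_mul]
      noncomm_ring
    rwa [this]
  have hz' : ∀ b ∈ B, ofRing R a₀ * ofRing R b = 0 := by
    intro b hb
    by_cases hbC : ofRing R b ∈ extendedCentroid R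
    · have := hz a₀ ha₀ (b + b₀) (add_mem hb hb₀) fun h => hb₀C (by
        simpa using sub_mem h hbC)
      rwa [map_add, mul_add, hz a₀ ha₀ b₀ hb₀ hb₀C, add_zero] at this
    · exact hz a₀ ha₀ b hb hbC
  rcases eq_zero_or_eq_zero (p := ofRing R a₀) (q := ofRing R b₀) fun r => by
    have h1 := hz' _ (hB b₀ hb₀ r)
    rw [map_sub, map_mul, map_mul, mul_sub, ← mul_assoc, hz' b₀ hb₀, zero_mul, zero_sub,
      neg_eq_zero, ← mul_assoc] at h1
    exact h1 with h | h
  · exact ha₀0 (ofRing_eq_zero.1 h)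
  · exact ne_zero_of_notMem hb₀C h

/-- From `u [k, r] u = 0` one gets `u k r u = u r k u`. Using this twice, then cancelling `u` by
primeness, gives `k u t u = u t k u`; hence `[u, k] t u = 0` for all `t`. This is the nilpotent case
of `commute_of_commute_mul`. -/
theorem commute_of_mul_mul_eq_zero {K : AddSubgroup R} (hK : IsLieIdeal K) {u : R}
    (huK : ∀ k ∈ K, u * k * u = 0) {k : R} (hk : k ∈ K) : u * k = k * u := by
  by_cases hu0 : u = 0
  · simp [hu0]
  have h1 : ∀ r, u * k * r * u = u * r * k * u := fun r => by
    have := huK _ (hK k hk r)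
    rw [← sub_eq_zero, ← this]; noncomm_ring
  have h2 : ∀ t, k * u * t * u = u * t * k * u := fun t => by
    rw [← sub_eq_zero]
    refine (IsPrimeRing.eq_zero_or_eq_zero u _ fun s => ?_).resolve_left hu0
    have e1 := h1 s
    have e2 := h1 (s * u * t)
    calc u * s * (k * u * t * u - u * t * k * u) = (u * s * k * u) * t * u -
        u * (s * u * t) * k * u := by noncomm_ring
      _ = 0 := by rw [← e1, ← e2]; noncomm_ring
  rw [← sub_eq_zero]
  refine (IsPrimeRing.eq_zero_or_eq_zero _ u fun t => ?_).resolve_right hu0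
  rw [sub_mul, sub_mul, h2, h1, sub_self]

end Martindale

section
open scoped Pointwise

theorem AddSubgroup.mul_mem_mul {R : Type*} [NonUnitalNonAssocRing R] {A B : AddSubgroup R}
    {a b : R} (ha : a ∈ A) (hb : b ∈ B) : a * b ∈ A * B :=
  AddSubmonoid.mul_mem_mul (M := A.toAddSubmonoid) (N := B.toAddSubmonoid) ha hb

theorem AddSubgroup.mul_induction_on {R : Type*} [NonUnitalNonAssocRing R] {A B : AddSubgroup R}
    {C : R → Prop} {p : R} (hp : p ∈ A * B) (mul_mem : ∀ a ∈ A, ∀ b ∈ B, C (a * b))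
    (add : ∀ p q, C p → C q → C (p + q)) : C p :=
  AddSubmonoid.mul_induction_on (M := A.toAddSubmonoid) (N := B.toAddSubmonoid) hp mul_mem add

theorem IsLieIdeal.mul {R : Type*} [NonUnitalRing R] {A B : AddSubgroup R} (hA : IsLieIdeal A)
    (hB : IsLieIdeal B) : IsLieIdeal (A * B) := by
  intro p hp r
  refine AddSubgroup.mul_induction_on (C := fun p => p * r - r * p ∈ A * B) hp
    (fun a ha b hb => ?_) fun p q hp hq => ?_
  · have : a * b * r - r * (a * b) = a * (b * r - r * b) + (a * r - r * a) * b := by noncomm_ring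
    rw [this]
    exact add_mem (AddSubgroup.mul_mem_mul ha (hB b hb r)) (AddSubgroup.mul_mem_mul (hA a ha r) hb)
  · have : (p + q) * r - r * (p + q) = (p * r - r * p) + (q * r - r * q) := by noncomm_ring
    rw [this]
    exact add_mem hp hq

theorem isLieIdeal_prodSubgroups {R : Type*} [NonUnitalRing R] (m : ℕ)
    (K : Fin (m + 1) → AddSubgroup R) (hK : ∀ j, IsLieIdeal (K j)) :
    IsLieIdeal (prodSubgroups m K) := by
  induction m with
  | zero => exact hK 0
  | succ m ih => exact (ih _ fun j => hK j.castSucc).mul (hK _)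

/-! ### From the centralizer of a product to the centralizers of its factors -/

namespace Martindale

variable {R : Type*} [NonUnitalRing R] [IsPrimeRing R]

open Qs

theorem not_mul_subset_center {A B : AddSubgroup R} (hB : IsLieIdeal B)
    (hAZ : ¬ (A : Set R) ⊆ Set.center R) (hBZ : ¬ (B : Set R) ⊆ Set.center R) :
    ¬ ((A * B : AddSubgroup R) : Set R) ⊆ Set.center R := by
  intro h
  obtain ⟨a₀, ha₀, ha₀C⟩ := exists_notMem_extendedCentroid hAZ
  obtain ⟨b₀, hb₀, hb₀C⟩ := exists_notMem_extendedCentroid hBZ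
  obtain ⟨a, ha, b, hb, hab⟩ := exists_mul_notMem_extendedCentroid hB ha₀ hb₀
    (fun h => ne_zero_of_notMem ha₀C (ofRing_eq_zero.2 h)) hb₀C
  rw [← map_mul, ← mem_center_iff] at hab
  exact hab (h (AddSubgroup.mul_mem_mul ha hb))

/-- If `u` commutes with all `u k`, `k ∈ K`, and `u ^ 2` is central, then `u` centralizes `K`. -/
theorem commute_of_commute_mul {K : AddSubgroup R} (hK : IsLieIdeal K) {u : R}
    (hu : ofRing R (u * u) ∈ extendedCentroid R) (h : ∀ k ∈ K, u * (u * k) = u * k * u)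
    {k : R} (hk : k ∈ K) : u * k = k * u := by
  by_cases h0 : u * u = 0
  · refine commute_of_mul_mul_eq_zero hK (fun k hk => ?_) hk
    rw [← h k hk, ← mul_assoc, h0, zero_mul]
  · refine ofRing_injective ?_
    have hne : (⟨_, hu⟩ : extendedCentroid R) ≠ 0 := fun e =>
      h0 (ofRing_eq_zero.1 (congrArg Subtype.val e))
    rw [← sub_eq_zero, ← map_sub]
    refine (eq_zero_of_smul_eq_zero (k := ⟨_, hu⟩) ?_).resolve_left hne
    rw [Subring.smul_def, smul_eq_mul, ← map_mul, ofRing_eq_zero]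
    have : u * u * (u * k - k * u) = u * (u * (u * k) - u * k * u) := by noncomm_ring
    rw [this, h k hk, sub_self, mul_zero]

theorem commute_of_smul_one_add {s t : extendedCentroid R} (ht : t ≠ 0) {x q : Qs R}
    (h : (s • 1 + t • x) * q = q * (s • 1 + t • x)) : x * q = q * x := by
  rw [← sub_eq_zero]
  refine (eq_zero_of_smul_eq_zero (k := t) ?_).resolve_left ht
  rw [← sub_eq_zero] at h
  rw [← h]
  simp only [add_mul, mul_add, smul_mul_assoc, mul_smul_comm, smul_sub, one_mul, mul_one]
  abel

/-- Lets a factor be removed: a `C`-linear identity valid on `K` may be evaluated at 1. -/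
theorem one_mem_extend {K : AddSubgroup R} (hK : IsLieIdeal K)
    (hKZ : ¬ (K : Set R) ⊆ Set.center R) {y : Qs R} (hy : y ∉ extendedCentroid R)
    (h : ∀ k ∈ K, y * ofRing R k = ofRing R k * y) : (1 : Qs R) ∈ extend (K : Set R) := by
  obtain ⟨k₀, hk₀, hk₀C⟩ := exists_notMem_extendedCentroid hKZ
  rw [(extend_eq_span_of_commute hK hk₀ hk₀C hy h).2.2]
  exact Submodule.subset_span (Set.mem_insert _ _)

/-- An element centralizing the product of two noncentral Lie ideals centralizes both factors. -/
theorem commute_of_commute_mul_lieIdeal {A B : AddSubgroup R} (hA : IsLieIdeal A)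
    (hB : IsLieIdeal B) (hAZ : ¬ (A : Set R) ⊆ Set.center R) (hBZ : ¬ (B : Set R) ⊆ Set.center R)
    {x : R} (hx : ofRing R x ∉ extendedCentroid R)
    (h : ∀ p ∈ A * B, ofRing R x * ofRing R p = ofRing R p * ofRing R x) :
    (∀ a ∈ A, ofRing R x * ofRing R a = ofRing R a * ofRing R x) ∧
      ∀ b ∈ B, ofRing R x * ofRing R b = ofRing R b * ofRing R x := by
  have hAB : ∀ a ∈ A, ∀ b ∈ B, ofRing R x * (ofRing R a * ofRing R b) =
      ofRing R a * ofRing R b * ofRing R x := fun a ha b hb => by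
    rw [← map_mul (ofRing R) a b]
    exact h _ (AddSubgroup.mul_mem_mul ha hb)
  by_cases hxA : ∀ a ∈ A, ofRing R x * ofRing R a = ofRing R a * ofRing R x
  · refine ⟨hxA, fun b hb => ?_⟩
    have : ∀ p ∈ extend (A : Set R), ofRing R x * (p * ofRing R b) =
        p * ofRing R b * ofRing R x := by
      intro p hp
      induction hp using Submodule.span_induction with
      | mem p hp => obtain ⟨a, ha, rfl⟩ := hp; exact hAB a ha b hb
      | zero => simp
      | add p p' _ _ hp hp' => simp only [add_mul, mul_add, hp, hp']
      | smul k p _ hp => simp only [mul_smul_comm, smul_mul_assoc, hp]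
    simpa using this 1 (one_mem_extend hA hAZ hx hxA)
  have hxB : ∀ b ∈ B, ofRing R x * ofRing R b = ofRing R b * ofRing R x := by
    intro b hb
    push Not at hxA
    obtain ⟨a₀, ha₀, hne⟩ := hxA
    obtain ⟨p, hp, hpC⟩ := exists_notMem_extendedCentroid (not_mul_subset_center hB hAZ hBZ)
    have hP := hA.mul hB
    obtain ⟨h2, hxx, hspan⟩ := extend_eq_span_of_commute hP hp hpC hx h
    -- `u` is a nonzero element of `A`. Writing a noncentral `p` of `A B` as `s + t x` gives `[p,
    -- a₀] = -t u`, so `u` also lies in `C + C x`. As `u B` lies in this commutative plane too, `u`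
    -- commutes with `u B`, and hence with `B`.
    set u := a₀ * x - x * a₀ with hu
    have huA : u ∈ A := hA a₀ ha₀ x
    have hmemP : ∀ q ∈ A * B, ofRing R q ∈ Submodule.span (extendedCentroid R) {1, ofRing R x} :=
      fun q hq => hspan ▸ Submodule.subset_span ⟨q, hq, rfl⟩
    obtain ⟨s, t, hst⟩ := Submodule.mem_span_pair.1 (hmemP p hp)
    have ht : t ≠ 0 := by
      rintro rfl
      rw [zero_smul, add_zero] at hst
      exact hpC (hst ▸ smul_mem_extendedCentroid _ (one_mem _))
    have huD : ofRing R u ∈ Submodule.span (extendedCentroid R) {1, ofRing R x} := by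
      obtain ⟨t', ht'⟩ := exists_mul_eq_one ht
      have : ofRing R u = (-t') • ofRing R (p * a₀ - a₀ * p) := by
        rw [hu]
        simp only [map_sub, map_mul, ← hst, add_mul, mul_add, smul_mul_assoc, mul_smul_comm,
          one_mul, mul_one, smul_add, smul_sub, smul_smul, neg_mul, neg_smul, ht', one_smul]
        abel
      rw [this]
      exact Submodule.smul_mem _ _ (hmemP _ (hP p hp a₀))
    have hxu : ofRing R u * ofRing R x = ofRing R x * ofRing R u :=
      (span_pair_commute huD rfl).symm
    have hub : ∀ b ∈ B, u * (u * b) = u * b * u := fun b hb => ofRing_injective <| by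
      rw [map_mul, map_mul _ (u * b)]
      exact span_pair_commute (hmemP _ (AddSubgroup.mul_mem_mul huA hb)) hxu
    obtain ⟨α, β, hαβ⟩ := Submodule.mem_span_pair.1 huD
    have huu : ofRing R (u * u) ∈ extendedCentroid R := by
      rw [map_mul, ← hαβ]
      exact mul_self_mem_extendedCentroid h2 hxx _ _
    have hcomm := congrArg (ofRing R) (commute_of_commute_mul hB huu hub hb)
    rw [map_mul, map_mul] at hcomm
    -- With `u = α + β x`: if `β = 0`, then `u` is a nonzero scalar that cancels from `[x, u b] =
    -- 0`; otherwise commuting with `u` means commuting with `x`.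
    by_cases hβ : β = 0
    · rw [hβ, zero_smul, add_zero] at hαβ
      have h1 := hAB u huA b hb
      rw [← hαβ] at h1
      simp only [smul_mul_assoc, mul_smul_comm, one_mul] at h1
      rw [← sub_eq_zero, ← smul_sub] at h1
      refine sub_eq_zero.1 ((eq_zero_of_smul_eq_zero h1).resolve_left ?_)
      rintro rfl
      rw [zero_smul] at hαβ
      apply hne
      rw [hu, map_sub, map_mul, map_mul] at hαβ
      exact (sub_eq_zero.1 hαβ.symm).symm
    · rw [← hαβ] at hcomm
      exact commute_of_smul_one_add hβ hcomm
  refine ⟨fun a ha => ?_, hxB⟩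
  have : ∀ p ∈ extend (B : Set R), ofRing R x * (ofRing R a * p) = ofRing R a * p * ofRing R x := by
    intro p hp
    induction hp using Submodule.span_induction with
    | mem p hp => obtain ⟨b, hb, rfl⟩ := hp; exact hAB a ha b hb
    | zero => simp
    | add p p' _ _ hp hp' => simp only [add_mul, mul_add, hp, hp']
    | smul k p _ hp => simp only [mul_smul_comm, smul_mul_assoc, hp]
  simpa using this 1 (one_mem_extend hB hBZ hx hxB)

/-! ### Arbitrarily many factors and the dichotomy -/

theorem not_prodSubgroups_subset_center (m : ℕ) (K : Fin (m + 1) → AddSubgroup R)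
    (hK : ∀ j, IsLieIdeal (K j)) (hKZ : ∀ j, ¬ (K j : Set R) ⊆ Set.center R) :
    ¬ (prodSubgroups m K : Set R) ⊆ Set.center R := by
  induction m with
  | zero => exact hKZ 0
  | succ m ih =>
    exact not_mul_subset_center (hK _) (ih _ (fun j => hK j.castSucc) fun j => hKZ j.castSucc)
      (hKZ _)

theorem commute_of_commute_prodSubgroups (m : ℕ) (K : Fin (m + 1) → AddSubgroup R)
    (hK : ∀ j, IsLieIdeal (K j)) (hKZ : ∀ j, ¬ (K j : Set R) ⊆ Set.center R)
    {x : R} (hx : ofRing R x ∉ extendedCentroid R)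
    (h : ∀ p ∈ prodSubgroups m K, ofRing R x * ofRing R p = ofRing R p * ofRing R x) (j) :
    ∀ k ∈ K j, ofRing R x * ofRing R k = ofRing R k * ofRing R x := by
  induction m with
  | zero => rw [Fin.fin_one_eq_zero j]; exact h
  | succ m ih =>
    have hK' := fun j : Fin (m + 1) => hK j.castSucc
    have hKZ' := fun j : Fin (m + 1) => hKZ j.castSucc
    obtain ⟨h1, h2⟩ := commute_of_commute_mul_lieIdeal
      (isLieIdeal_prodSubgroups m _ hK') (hK (Fin.last _))
      (not_prodSubgroups_subset_center m _ hK' hKZ') (hKZ _) hx h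
    refine Fin.lastCases h2 (fun i => ?_) j
    exact ih _ hK' hKZ' h1 i

/-- A dependence with nonzero coefficient at `x` would make `x` central. The default value of
`finrank` is 0, so 2 is a genuine dimension. -/
theorem finrank_span_one_pair {x : Qs R} (hx : x ∉ extendedCentroid R) :
    Module.finrank (extendedCentroid R) (Submodule.span (extendedCentroid R) {1, x}) = 2 := by
  have hli : LinearIndependent (extendedCentroid R) ![1, x] := by
    refine LinearIndependent.pair_iff.2 fun s t hst => ?_
    have ht : t = 0 := by
      by_contra ht
      refine hx (mem_extendedCentroid_of_smul ht ?_)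
      rw [eq_neg_of_add_eq_zero_right hst]
      exact neg_mem (smul_mem_extendedCentroid _ (one_mem _))
    rw [ht, zero_smul, add_zero] at hst
    exact ⟨(eq_zero_of_smul_eq_zero hst).resolve_right one_ne_zero, ht⟩
  have := finrank_span_eq_card hli
  rwa [Matrix.range_cons_cons_empty, Fintype.card_fin] at this

end Martindale
end

open Martindale Qs in
theorem mainTheorem10 {R : Type*} [NonUnitalRing R] [IsPrimeRing R] (m : ℕ)
    (K : Fin (m + 1) → AddSubgroup R) (hK : ∀ j, IsLieIdeal (K j))
    (hKZ : ∀ j, ¬ (K j : Set R) ⊆ Set.center R) :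
    Set.centralizer (prodSubgroups m K : Set R) = Set.center R ∨
      ((∀ j, Martindale.extend (K j : Set R) = Martindale.extend (K 0 : Set R)) ∧
        Module.finrank (Martindale.extendedCentroid R) (Martindale.extend (K 0 : Set R)) = 2 ∧
        {x : Martindale.Qs R | x ∈ Martindale.centralClosure R ∧
            ∀ a ∈ prodSubgroups m K, Martindale.Qs.ofRing R a * x = x * Martindale.Qs.ofRing R a} =
          (Martindale.extend (K 0 : Set R) : Set (Martindale.Qs R))) := by
  refine or_iff_not_imp_left.2 fun hne => ?_
  obtain ⟨x, hx, hxC⟩ : ∃ x ∈ Set.centralizer (prodSubgroups m K : Set R),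
      ofRing R x ∉ extendedCentroid R := by
    by_contra! h
    exact hne (Set.Subset.antisymm (fun x hx => mem_center_iff.2 (h x hx))
      (Set.center_subset_centralizer _))
  have hxP : ∀ p ∈ prodSubgroups m K, ofRing R x * ofRing R p = ofRing R p * ofRing R x :=
    fun p hp => by rw [← map_mul, ← map_mul, hx p hp]
  have hspan : ∀ j, extend (K j : Set R) =
      Submodule.span (extendedCentroid R) {1, ofRing R x} := fun j => by
    obtain ⟨k₀, hk₀, hk₀C⟩ := exists_notMem_extendedCentroid (hKZ j)
    exact (extend_eq_span_of_commute (hK j) hk₀ hk₀C hxC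
      (commute_of_commute_prodSubgroups m K hK hKZ hxC hxP j)).2.2
  refine ⟨fun j => by rw [hspan, hspan], by rw [hspan]; exact finrank_span_one_pair hxC, ?_⟩
  ext y
  refine ⟨fun ⟨_, hy⟩ => ?_, fun hy => ⟨?_, fun p hp => ?_⟩⟩
  · rw [hspan, SetLike.mem_coe]
    by_cases hyC : y ∈ extendedCentroid R
    · exact Submodule.mem_span_pair.2 ⟨⟨y, hyC⟩, 0, by rw [Subring.smul_def]; simp⟩
    have hP := isLieIdeal_prodSubgroups m K hK
    obtain ⟨p, hp, hpC⟩ :=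
      exists_notMem_extendedCentroid (not_prodSubgroups_subset_center m K hK hKZ)
    -- Both `x` and `y` are noncentral and centralize the product, so each spans with 1 the same
    -- space: the extension of the product.
    rw [← (extend_eq_span_of_commute hP hp hpC hxC hxP).2.2,
      (extend_eq_span_of_commute hP hp hpC hyC fun p hp => (hy p hp).symm).2.2]
    exact Submodule.subset_span (Set.mem_insert_of_mem _ rfl)
  · exact Submodule.span_mono (Set.image_mono (Set.subset_univ _)) hy
  · rw [hspan] at hy
    exact span_pair_commute hy (hxP p hp).symm
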